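/- Let $I$ be a set. An $I$-graded (many-sorted) Lawvere theory is a small category $T$ with finite products together with a family of objects $(s_i)_{i\in I}$ of $T$ such that every object of $T$ is isomorphic to a finite (possibly empty) product of objects $s_i$. For a category $\mathcal D$, a model of $T$ in $\mathcal D$ is a functor $T\to\mathcal D$ preserving finite products; morphisms of models are natural transformations, and a model $M$ has underlying $I$-graded object $i\mapsto M(s_i)$. The variety of graded algebras $\mathcal V^*$ of $T$ is the category of models of $T$ in $\mathbf{Set}$. The category $\mathcal C$ of co-$\mathcal V^*$-algebra objects in $\mathcal V^*$ is the opposite of the category of models of $T$ in $(\mathcal V^*)^{\mathrm{op}}$. Let $|\cdot|\colon \mathcal C\to(\mathcal V^*)^I$ be the underlying graded object functor. An object $X$ of $\mathcal C$ defines a functor $\mathrm{Hom}(X,-)\colon\mathcal V^*\to\mathcal V^*$, where $\mathrm{Hom}(X,A)$ is the model $t\mapsto\mathrm{Hom}_{\mathcal V^*}(X(t),A)$. A functor $G\colon\mathcal V^*\to\mathcal V^*$ is called representable if there are objects $X_i$ of $\mathcal V^*$ $(i\in I)$ and bijections $G(A)(s_i)\cong\mathrm{Hom}_{\mathcal V^*}(X_i,A)$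 natural in $A$. **Theorem.** 1. The forgetful functor $\mathcal V^*\to\mathbf{Set}^I$ has a left adjoint $F$ (the free functor). 2. The representable functors $\mathcal V^*\to\mathcal V^*$ include the identity functor and are closed under composition, and hence form a monoidal category $\mathrm{Rep}(\mathcal V^*,\mathcal V^*)$ under composition $(G,H)\mapsto G\circ H$. The category $\mathcal C$ carries a monoidal structure $(\mathcal C,\odot,\mathbb I)$ (the Tall–Wraith monoidal structure) such that $X\mapsto\mathrm{Hom}(X,-)$ is an equivalence of monoidal categories $\mathcal C^{\mathrm{op}}\to\mathrm{Rep}(\mathcal V^*,\mathcal V^*)$; in particular $\mathrm{Hom}(X\odot Y,-)\cong\mathrm{Hom}(X,\mathrm{Hom}(Y,-))$. 3. Let $F$ be any left adjoint of the forgetful functor, let $\tilde F\colon\mathbf{Set}^{I\times I}\to(\mathcal V^*)^I$ be its degreewise extension, $\tilde F(Z)(i)=F(Z(i,-))$, and let $\Delta\colon\mathbf{Set}\to\mathbf{Set}^{I\times I}$ be the diagonal functor, $\Delta(S)(i,j)=S$ if $i=j$ and $\Delta(S)(i,j)=\emptyset$ otherwise. Then $\tilde F\Delta$ has a lift to a strong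 monoidal functor: there is a strong monoidal functor $\hat F\colon(\mathbf{Set},\times,\{*\})\to(\mathcal C,\odot,\mathbb I)$ with $|\cdot|\circ\hat F\cong\tilde F\Delta$ naturally. -/

import Mathlib

open CategoryTheory Limits Opposite MonoidalOpposite

universe w u v₁ u₁ v₂ u₂

-- Endofunctors of a category form a monoidal category under composition. In Mathlib's convention
-- `F ⊗ G = F ⋙ G` (first `F`, then `G`).
attribute [local instance] endofunctorMonoidalCategory

noncomputable section

namespace TallWraith

/-- A category `T` with finite products, together with a family of distinguished objects
`s i : T` (the sorts), is a graded (many-sorted) Lawvere theory if every object is isomorphic to a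
finite (possibly empty) product of sorts. -/
def IsGradedLawvereTheory {I : Type w} {T : Type u₁} [Category.{v₁} T] [HasFiniteProducts T]
    (s : I → T) : Prop :=
  ∀ t : T, ∃ (n : ℕ) (k : Fin n → I), Nonempty (t ≅ ∏ᶜ fun j => s (k j))

section Models

variable (T : Type u₁) [Category.{v₁} T] (D : Type u₂) [Category.{v₂} D]

/-- Being a functor that preserves finite products. -/
def isModel : ObjectProperty (T ⥤ D) := fun F => PreservesFiniteProducts F

/-- The category of models of the theory `T` in `D`: functors preserving finite products, and all
natural transformations between them. -/
abbrev Model := (isModel T D).FullSubcategory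

/-- The category of co-`T`-algebra objects in `D`: the opposite of the category of models
of `T` in `Dᵒᵖ`. -/
abbrev CoModel := (Model T Dᵒᵖ)ᵒᵖ

variable {T} {I : Type w} (s : I → T)

/-- The underlying graded object of a model: `M ↦ (i ↦ M (s i))`. -/
def Model.underlying : Model T D ⥤ GradedObject I D :=
  Functor.pi' fun i => (isModel T D).ι ⋙ (evaluation T D).obj (s i)

/-- The underlying graded object of a co-algebra object. -/
def CoModel.underlying : CoModel T D ⥤ GradedObject I D :=
  Functor.pi' fun i => ((isModel T Dᵒᵖ).ι ⋙ (evaluation T Dᵒᵖ).obj (s i)).leftOp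

end Models

section Hom

variable {T : Type u₁} [Category.{v₁} T] {D : Type u₂} [Category.{v₂} D]

/-- For a co-`T`-algebra object `X` in `D` and an object `A` of `D`, the functor
`t ↦ Hom_D(X t, A)`; it is a model of `T` in sets, with underlying graded set
`i ↦ Hom_D(X (s i), A)`. -/
def homModel (X : CoModel T D) (A : D) : Model T (Type v₂) where
  obj := X.unop.obj ⋙ yoneda.obj A
  property := by
    have : PreservesFiniteProducts X.unop.obj := X.unop.property
    change PreservesFiniteProducts (X.unop.obj ⋙ yoneda.obj A)
    exact Limits.comp_preservesFiniteProducts _ _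

variable (T D)

/-- The contravariant functor `X ↦ Hom_D(X, -)` sending a co-`T`-algebra object in `D` to the
covariant functor that it represents, from `D` to the category of models of `T` in sets. -/
def homFunctor : (CoModel T D)ᵒᵖ ⥤ D ⥤ Model T (Type v₂) where
  obj X :=
    { obj A := homModel X.unop A
      map f := ObjectProperty.homMk (Functor.whiskerLeft X.unop.unop.obj (yoneda.map f)) }
  map g :=
    { app A := ObjectProperty.homMk (Functor.whiskerRight g.unop.unop.hom (yoneda.obj A))
      naturality A B f := by
        apply ObjectProperty.hom_ext
        ext t x
        exact Category.assoc _ _ _ |>.symm }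

end Hom

section Variety

variable (T : Type u) [SmallCategory T]

/-- The variety of algebras of the theory `T`: the category of its models in sets. -/
abbrev Variety := Model T (Type u)

/-- The functors from the variety to itself. As a monoidal category, the tensor product is
composition in the usual order: `F ⊗ G = F ∘ G` (first `G`, then `F`). -/
abbrev CovFun := (Variety T ⥤ Variety T)ᴹᵒᵖ

/-- The co-`T`-algebra objects in the variety of `T`-algebras. -/
abbrev CoAlg := CoModel T (Variety T)

variable {T} {I : Type u} (s : I → T)

/-- A functor `G` from the variety to itself is representable if its underlying functor to graded
sets is representable by a graded object: there are objects `X i` of the variety with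
`G(A)(s i) ≅ Hom(X i, A)`, naturally in `A`, for each `i`. -/
def covRep : ObjectProperty (CovFun T) := fun G =>
  ∃ X : GradedObject I (Variety T), ∀ i : I, Nonempty
    (coyoneda.obj (op (X i)) ≅ G.unmop ⋙ (isModel T (Type u)).ι ⋙ (evaluation T (Type u)).obj (s i))

variable (T) in
/-- `X ↦ Hom(X, -)`, as a functor to the (monoidal) category of endofunctors of the variety. -/
def toCovFun : (CoAlg T)ᵒᵖ ⥤ CovFun T := homFunctor T (Variety T) ⋙ mopFunctor _

lemma covRep_toCovFun (X : (CoAlg T)ᵒᵖ) : covRep s ((toCovFun T).obj X) :=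
  ⟨(CoModel.underlying (Variety T) s).obj X.unop, fun _ => ⟨Iso.refl _⟩⟩

/-- `X ↦ Hom(X, -)`, as a functor from the opposite of the category of co-algebra objects to the
category of representable endofunctors of the variety. -/
def toCovRep : (CoAlg T)ᵒᵖ ⥤ (covRep s).FullSubcategory :=
  (covRep s).lift (toCovFun T) (covRep_toCovFun s)

open scoped Classical in
variable (I) in
/-- The diagonal functor: `S ↦ (i ↦ (j ↦ S if j = i, and ∅ otherwise))`. -/
def diag : Type u ⥤ GradedObject I (GradedObject I (Type u)) :=
  Functor.pi' fun i => GradedObject.single i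

/-- The degreewise extension of a functor `F` on graded sets to `I × I`-graded sets:
`(i ↦ X i) ↦ (i ↦ F (X i))`. -/
def extend {C : Type u₁} [Category.{v₁} C] (F : GradedObject I (Type u) ⥤ C) :
    GradedObject I (GradedObject I (Type u)) ⥤ GradedObject I C :=
  Functor.pi fun _ => F

end Variety

end TallWraith

end

-- By the Yoneda lemma `X ↦ Hom(X, -)` is fully faithful. Its essential image is the class of
-- representable functors: every object of `T` is a finite product of sorts, so representing objects
-- at the sorts give, by finite coproducts, representing objects at every `t`
-- (`homFunctor_mem_essImage`). The variety is reflective in presheaves, hence cocomplete, so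
-- `Hom(X, -)` has a left adjoint by Kan extension along Yoneda. If `L ⊣ H` then `Hom(Xᵢ, H -) ≅
-- Hom(L Xᵢ, -)`, so representable functors compose, and the co-algebras receive their monoidal
-- structure by transport. The strong monoidal lift comes from the powers `A ↦ A ^ S`: currying
-- makes `S ↦ (-) ^ S` monoidal, and the free model on `S` generators of degree `i` represents `A ↦
-- A(sᵢ) ^ S`.

universe v

namespace TallWraith

/-! ### Cocompleteness of the variety -/

section Colimits

variable (T : Type u) [SmallCategory T]

instance isCardinalPresentable_shrinkYoneda_obj {C : Type u} [SmallCategory C]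
    (κ : Cardinal.{u}) [Fact κ.IsRegular] (X : C) :
    IsCardinalPresentable (shrinkYoneda.{u}.obj X) κ := by
  have e : uliftYoneda.{u}.obj X ≅ shrinkYoneda.{u}.obj X :=
    NatIso.ofComponents
      (fun Y => (Equiv.ulift.trans shrinkYonedaObjObjEquiv.symm).toIso) (fun f => by
        ext x
        exact (shrinkYoneda_obj_map_shrinkYonedaObjObjEquiv_symm f x.down).symm)
  exact isCardinalPresentable_of_iso e κ

/-- The morphisms of presheaves that detect preservation of finite products. -/
def finiteProductMorphisms (C : Type u) [SmallCategory C] :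
    MorphismProperty (Cᵒᵖ ⥤ Type u) :=
  ⨆ (n : ℕ), ⨆ (F : Discrete (Fin n) ⥤ Cᵒᵖ),
    MorphismProperty.ofHoms (Presheaf.preservesLimitHomFamily F)

lemma isLocal_finiteProductMorphisms (C : Type u) [SmallCategory C] :
    (finiteProductMorphisms C).isLocal = isModel Cᵒᵖ (Type u) := by
  rw [finiteProductMorphisms, MorphismProperty.isLocal_iSup]
  simp only [← Presheaf.preservesLimitsOfShape_eq_isLocal]
  ext P
  simp only [iInf_apply, iInf_Prop_eq]
  exact ⟨fun h => ⟨h⟩, fun h n => h.preserves n⟩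

instance (C : Type u) [SmallCategory C] : (isModel Cᵒᵖ (Type u)).ι.IsRightAdjoint := by
  rw [← isLocal_finiteProductMorphisms]
  have : Fact Cardinal.aleph0.{u}.IsRegular := Cardinal.fact_isRegular_aleph0
  have : MorphismProperty.IsSmall.{u} (finiteProductMorphisms C) := by
    unfold finiteProductMorphisms
    infer_instance
  refine MorphismProperty.isRightAdjoint_ι_isLocal (finiteProductMorphisms C) Cardinal.aleph0.{u} ?_
  intro X Y f hf
  simp only [finiteProductMorphisms, MorphismProperty.iSup_iff] at hf
  obtain ⟨n, F, ⟨h⟩⟩ := hf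
  -- The domain is a finite colimit of representables and the codomain is representable, so both are
  -- finitely presentable.
  constructor
  · have (k : (Discrete (Fin n))ᵒᵖ) : IsCardinalPresentable
        ((F.leftOp ⋙ shrinkYoneda.{u}).obj k) Cardinal.aleph0.{u} :=
      isCardinalPresentable_shrinkYoneda_obj _ _
    refine isCardinalPresentable_of_isColimit _ (colimit.isColimit _) _ ?_
    rw [hasCardinalLT_aleph0_iff]
    infer_instance
  · infer_instance

instance isModel_isClosedUnderIsomorphisms (T : Type u₁) [Category.{v₁} T] (D : Type u₂)
    [Category.{v₂} D] : (isModel T D).IsClosedUnderIsomorphisms where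
  of_iso e h := ⟨fun n => by
    have := h.preserves n
    exact preservesLimitsOfShape_of_natIso e⟩

/-- Models of `T` are the same as models of `Tᵒᵖᵒᵖ`. -/
def modelOpOpEquivalence : Variety T ≌ Model Tᵒᵖᵒᵖ (Type u) :=
  (opOpEquivalence T).symm.congrLeft.congrFullSubcategory (by
    ext F
    constructor
    · intro h
      have : PreservesFiniteProducts (unopUnop T ⋙ F) := h
      exact (isModel T (Type u)).prop_of_iso
        (Functor.isoWhiskerRight (opOpEquivalence T).counitIso F)
        (comp_preservesFiniteProducts (opOp T) (unopUnop T ⋙ F))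
    · intro h
      have : PreservesFiniteProducts F := h
      exact comp_preservesFiniteProducts (unopUnop T) F)

/-- Models on `Cᵒᵖ` are the presheaves local for a small class of maps, hence reflective; apply this
with `C = Tᵒᵖ`. -/
instance hasColimits_variety : HasColimits (Variety T) := by
  have : HasColimits (Model Tᵒᵖᵒᵖ (Type u)) :=
    have : Reflective (isModel Tᵒᵖᵒᵖ (Type u)).ι :=
      { L := _, adj := Adjunction.ofIsRightAdjoint _ }
    hasColimits_of_reflective (isModel Tᵒᵖᵒᵖ (Type u)).ι
  exact Adjunction.has_colimits_of_equivalence (modelOpOpEquivalence T).functor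

end Colimits

/-! ### Full faithfulness and essential image of `X ↦ Hom(X, -)` -/

section Representability

variable {T : Type u₁} [Category.{v₁} T] {D : Type u₂} [Category.{v₂} D]

/-- A functor to the models of `T` in sets, seen as a functor from `T` to set-valued functors. -/
abbrev flipModel (G : D ⥤ Model T (Type w)) : T ⥤ D ⥤ Type w :=
  (G ⋙ (isModel T (Type w)).ι).flip

lemma preservesFiniteProducts_flipModel (G : D ⥤ Model T (Type w)) :
    PreservesFiniteProducts (flipModel G) :=
  ⟨fun n => preservesLimitsOfShape_of_evaluation _ _ fun A =>
    have : PreservesFiniteProducts (G.obj A).obj := (G.obj A).property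
    inferInstanceAs (PreservesLimitsOfShape (Discrete (Fin n)) (G.obj A).obj)⟩

lemma flipModel_mem_essImage_coyoneda [HasFiniteProducts T] [HasFiniteCoproducts D]
    {I : Type w} {s : I → T} (hs : IsGradedLawvereTheory s) (G : D ⥤ Model T (Type v₂))
    (hG : ∀ i, (coyoneda (C := D)).essImage ((flipModel G).obj (s i))) (t : T) :
    (coyoneda (C := D)).essImage ((flipModel G).obj t) := by
  obtain ⟨n, k, ⟨e⟩⟩ := hs t
  choose X hX using hG
  have := preservesFiniteProducts_flipModel G
  -- This product lives in `Dᵒᵖ`: it is the coproduct in `D` of the representing objects.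
  exact ⟨∏ᶜ fun j => X (k j), ⟨PreservesProduct.iso coyoneda (fun j => X (k j)) ≪≫
    Pi.mapIso (fun j => (hX (k j)).some) ≪≫
    (PreservesProduct.iso (flipModel G) (fun j => s (k j))).symm ≪≫ (flipModel G).mapIso e.symm⟩⟩

/-- The action of a natural transformation `Hom(X, -) ⟶ Hom(Y, -)` on morphisms. -/
def homFunctorApp {X Y : (CoModel T D)ᵒᵖ} (α : (homFunctor T D).obj X ⟶ (homFunctor T D).obj Y)
    {t : T} {A : D} (x : (X.unop.unop.obj.obj t).unop ⟶ A) :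
    (Y.unop.unop.obj.obj t).unop ⟶ A :=
  (α.app A).hom.app t x

lemma homFunctorApp_comp {X Y : (CoModel T D)ᵒᵖ}
    (α : (homFunctor T D).obj X ⟶ (homFunctor T D).obj Y) {t : T} {A B : D}
    (x : (X.unop.unop.obj.obj t).unop ⟶ A) (f : A ⟶ B) :
    homFunctorApp α (x ≫ f) = homFunctorApp α x ≫ f :=
  ConcreteCategory.congr_hom (NatTrans.congr_app (congrArg
    (fun g : ((homFunctor T D).obj X).obj A ⟶ ((homFunctor T D).obj Y).obj B => g.hom)
    (α.naturality f)) t) x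

lemma homFunctorApp_map_comp {X Y : (CoModel T D)ᵒᵖ}
    (α : (homFunctor T D).obj X ⟶ (homFunctor T D).obj Y) {t t' : T} (f : t ⟶ t') {A : D}
    (x : (X.unop.unop.obj.obj t).unop ⟶ A) :
    homFunctorApp α ((X.unop.unop.obj.map f).unop ≫ x) =
      (Y.unop.unop.obj.map f).unop ≫ homFunctorApp α x :=
  (α.app A).hom.naturality_apply f x

/-- `X ↦ Hom(X, -)` is fully faithful, by the Yoneda lemma. -/
def homFunctorFullyFaithful : (homFunctor T D).FullyFaithful where
  preimage {X Y} α := Quiver.Hom.op (Quiver.Hom.op (ObjectProperty.homMk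
    { app t := Quiver.Hom.op (homFunctorApp α (𝟙 (X.unop.unop.obj.obj t).unop))
      naturality t t' f := by
        apply Quiver.Hom.unop_inj
        dsimp
        rw [← homFunctorApp_comp, ← homFunctorApp_map_comp, Category.id_comp, Category.comp_id] }))
  map_preimage {X Y} α := by
    ext A : 2
    apply ObjectProperty.hom_ext
    ext t x
    exact (homFunctorApp_comp α (𝟙 _) x).symm.trans
      (congrArg (homFunctorApp α) (Category.id_comp _))
  preimage_map {X Y} g := by
    apply Quiver.Hom.unop_inj
    apply Quiver.Hom.unop_inj
    apply ObjectProperty.hom_ext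
    ext t
    apply Quiver.Hom.unop_inj
    exact Category.comp_id _

instance : (homFunctor T D).Full := homFunctorFullyFaithful.full
instance : (homFunctor T D).Faithful := homFunctorFullyFaithful.faithful

/-- Since `coyoneda` is fully faithful, pointwise representing objects assemble into a functor `X`.
Since it also reflects limits, `X` inherits preservation of finite products from `flipModel G`. -/
lemma homFunctor_mem_essImage (G : D ⥤ Model T (Type v₂))
    (hG : ∀ t, (coyoneda (C := D)).essImage ((flipModel G).obj t)) :
    (homFunctor T D).essImage G := by
  let X : T ⥤ Dᵒᵖ := Functor.essImage.liftFunctor (flipModel G) coyoneda hG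
  let e : X ⋙ coyoneda ≅ flipModel G :=
    Functor.essImage.liftFunctorCompIso (flipModel G) coyoneda hG
  have hX : PreservesFiniteProducts X := ⟨fun n => by
    have := (preservesFiniteProducts_flipModel G).preserves n
    have := preservesLimitsOfShape_of_natIso (J := Discrete (Fin n)) e.symm
    exact preservesLimitsOfShape_of_reflects_of_preserves X coyoneda⟩
  exact ⟨op (op ⟨X, hX⟩), ⟨((isModel T (Type v₂)).fullyFaithfulι.whiskeringRight D).preimageIso
    ((flipFunctor _ _ _).mapIso e)⟩⟩

end Representability

/-! ### Left adjoints and free models -/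

section Adjoint

variable {T : Type u} [SmallCategory T]

/-- For a co-algebra object `X`, the functor `Hom(X, -)` has a left adjoint. -/
lemma isRightAdjoint_homFunctor_obj (X : (CoAlg T)ᵒᵖ) :
    ((homFunctor T (Variety T)).obj X).IsRightAdjoint := by
  let A : Tᵒᵖ ⥤ Variety T := X.unop.unop.obj.leftOp
  let R : Variety T ⥤ (Tᵒᵖᵒᵖ ⥤ Type u) :=
    (isModel T (Type u)).ι ⋙ (opOpEquivalence T).symm.congrLeft.functor
  let hR : R.FullyFaithful := (isModel T (Type u)).fullyFaithfulι.comp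
    (opOpEquivalence T).symm.congrLeft.fullyFaithfulFunctor
  let adj := Presheaf.uliftYonedaAdjunction.{u} _ (uliftYoneda.{u}.leftKanExtensionUnit A)
  have e : 𝟭 _ ⋙ Presheaf.restrictedULiftYoneda.{u} A ≅ (homFunctor T (Variety T)).obj X ⋙ R :=
    NatIso.ofComponents (fun B => NatIso.ofComponents (fun t => Equiv.ulift.toIso))
  -- By `e`, the restricted Yoneda functor of `A` takes values in models, so its left adjoint can be
  -- restricted along the full embedding `R`.
  exact (adj.restrictFullyFaithful hR (.id _) (Functor.rightUnitor _).symm e).isRightAdjoint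

/-- The representable functor `T(t, -)`, as a model. -/
noncomputable def freeModel (t : T) : Variety T where
  obj := coyoneda.obj (op t)
  property := ⟨fun _ => inferInstance⟩

/-- The Yoneda lemma for models. -/
noncomputable def freeModelHomEquiv {t : T} {A : Variety T} : (freeModel t ⟶ A) ≃ A.obj.obj t :=
  (isModel T (Type u)).fullyFaithfulι.homEquiv.trans coyonedaEquiv

/-- The coproduct of free models on generators indexed by `Z` corepresents maps of graded sets
out of `Z`. -/
noncomputable def freeModelCorepresentableBy {I : Type u} (s : I → T)
    (Z : GradedObject I (Type u)) :
    (Model.underlying (Type u) s ⋙ coyoneda.obj (op Z)).CorepresentableBy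
      (∐ fun z : Σ i, Z i => freeModel (s z.1)) where
  homEquiv {A} :=
    { toFun f i := ↾fun z =>
        freeModelHomEquiv (Sigma.ι (fun z : Σ i, Z i => freeModel (s z.1)) ⟨i, z⟩ ≫ f)
      invFun g := Sigma.desc fun z => freeModelHomEquiv.symm (g z.1 z.2)
      left_inv f := by
        apply Sigma.hom_ext
        intro z
        rw [Sigma.ι_desc]
        exact freeModelHomEquiv.symm_apply_apply _
      right_inv g := by
        funext i
        ext z
        change freeModelHomEquiv (Sigma.ι (fun z : Σ i, Z i => freeModel (s z.1)) ⟨i, z⟩ ≫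
          Sigma.desc _) = _
        rw [Sigma.ι_desc]
        exact freeModelHomEquiv.apply_symm_apply _ }
  homEquiv_comp g f := by
    funext i
    ext z
    exact congrArg freeModelHomEquiv (Category.assoc _ _ _).symm

lemma isRightAdjoint_underlying {I : Type u} (s : I → T) :
    (Model.underlying (Type u) s).IsRightAdjoint := by
  apply Functor.isRightAdjoint_of_leftAdjointObjIsDefined_eq_top
  ext Z
  simpa using! (freeModelCorepresentableBy s Z).isCorepresentable

end Adjoint

/-! ### Monoidal functors and opposites -/

section Opposites

open MonoidalCategory Functor.LaxMonoidal Functor.OplaxMonoidal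

variable {C : Type u₁} [Category.{v₁} C] [MonoidalCategory C]
  {D : Type u₂} [Category.{v₂} D] [MonoidalCategory D]

/-- The opposite of a contravariant monoidal functor is monoidal. -/
@[reducible]
def monoidalRightOp (F : Cᵒᵖ ⥤ D) [F.Monoidal] : F.rightOp.Monoidal :=
  Functor.CoreMonoidal.toMonoidal
    { εIso := (Functor.Monoidal.εIso F).symm.op
      μIso X Y := (Functor.Monoidal.μIso F (op X) (op Y)).symm.op
      μIso_hom_natural_left f X := Quiver.Hom.unop_inj (δ_natural_left F f.op (op X))
      μIso_hom_natural_right X f := Quiver.Hom.unop_inj (δ_natural_right F (op X) f.op)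
      associativity X Y Z := Quiver.Hom.unop_inj (by simp)
      left_unitality X := Quiver.Hom.unop_inj (by simp)
      right_unitality X := Quiver.Hom.unop_inj (by simp) }

/-- A contravariant functor is monoidal if its opposite is. -/
@[reducible]
def monoidalOfRightOp (F : Cᵒᵖ ⥤ D) [F.rightOp.Monoidal] : F.Monoidal :=
  Functor.CoreMonoidal.toMonoidal
    { εIso := (Functor.Monoidal.εIso F.rightOp).symm.unop
      μIso X Y := (Functor.Monoidal.μIso F.rightOp X.unop Y.unop).symm.unop
      μIso_hom_natural_left f X := Quiver.Hom.op_inj (δ_natural_left F.rightOp f.unop X.unop)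
      μIso_hom_natural_right X f := Quiver.Hom.op_inj (δ_natural_right F.rightOp X.unop f.unop)
      associativity X Y Z := Quiver.Hom.op_inj (by
        simpa using! (Functor.OplaxMonoidal.associativity_inv F.rightOp X.unop Y.unop Z.unop).symm)
      left_unitality X := Quiver.Hom.op_inj (by
        simpa using! Functor.OplaxMonoidal.left_unitality F.rightOp X.unop)
      right_unitality X := Quiver.Hom.op_inj (by
        simpa using! Functor.OplaxMonoidal.right_unitality F.rightOp X.unop) }

end Opposites

/-! ### Representable endofunctors -/

section Representable

variable {T : Type u} [SmallCategory T] {I : Type u} {s : I → T}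

lemma toCovRep_essSurj [HasFiniteProducts T] (hs : IsGradedLawvereTheory s) :
    (toCovRep s).EssSurj where
  mem_essImage G := by
    obtain ⟨X, hX⟩ := G.property
    obtain ⟨Y, ⟨e⟩⟩ := homFunctor_mem_essImage G.obj.unmop
      (flipModel_mem_essImage_coyoneda hs G.obj.unmop fun i => ⟨op (X i), hX i⟩)
    exact ⟨Y, ⟨(covRep s).isoMk ((mopFunctor _).mapIso e)⟩⟩

instance : (toCovFun T).Full :=
  have : (mopFunctor (Variety T ⥤ Variety T)).Full := (mopEquiv _).full_functor
  Functor.Full.comp (homFunctor T (Variety T)) (mopFunctor _)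

instance : (toCovFun T).Faithful :=
  have : (mopFunctor (Variety T ⥤ Variety T)).Faithful := (mopEquiv _).faithful_functor
  Functor.Faithful.comp (homFunctor T (Variety T)) (mopFunctor _)

instance : (toCovRep s).Full := inferInstanceAs ((covRep s).lift _ _).Full
instance : (toCovRep s).Faithful := inferInstanceAs ((covRep s).lift _ _).Faithful

lemma toCovRep_isEquivalence [HasFiniteProducts T] (hs : IsGradedLawvereTheory s) :
    (toCovRep s).IsEquivalence where
  essSurj := toCovRep_essSurj hs

lemma isRightAdjoint_of_covRep [HasFiniteProducts T] (hs : IsGradedLawvereTheory s)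
    {G : CovFun T} (hG : covRep s G) : G.unmop.IsRightAdjoint := by
  have := toCovRep_essSurj hs
  let e : (toCovFun T).obj ((toCovRep s).objPreimage ⟨G, hG⟩) ≅ G :=
    (covRep s).ι.mapIso ((toCovRep s).objObjPreimageIso ⟨G, hG⟩)
  exact @Functor.isRightAdjoint_of_iso _ _ _ _ _ _ ((unmopFunctor _).mapIso e)
    (isRightAdjoint_homFunctor_obj ((toCovRep s).objPreimage ⟨G, hG⟩))

/-- The free model `T(s i, -)` represents evaluation at `s i`, which handles the identity. For `G ∘
H`, apply the left adjoint of `H` to the objects representing `G`. -/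
lemma covRep_isMonoidal [HasFiniteProducts T] (hs : IsGradedLawvereTheory s) :
    (covRep s).IsMonoidal where
  prop_unit := ⟨fun i => freeModel (s i), fun i =>
    ⟨NatIso.ofComponents fun A => freeModelHomEquiv.toIso⟩⟩
  prop_tensor G H hG hH := by
    obtain ⟨X, hX⟩ := hG
    have := isRightAdjoint_of_covRep hs hH
    let adj := Adjunction.ofIsRightAdjoint H.unmop
    exact ⟨fun i => H.unmop.leftAdjoint.obj (X i), fun i =>
      ⟨(adj.corepresentableBy (X i)).toIso ≪≫ Functor.isoWhiskerLeft H.unmop (hX i).some⟩⟩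

end Representable

/-! ### Powers as a monoidal functor -/

section Power

open MonoidalCategory

variable (T : Type u) [SmallCategory T]

/-- The functor sending a model to its `S`-th power. -/
def powerFunctor (S : Type u) : Variety T ⥤ Variety T where
  obj A :=
    { obj := A.obj ⋙ coyoneda.obj (op S)
      property := by
        have : PreservesFiniteProducts A.obj := A.property
        exact comp_preservesFiniteProducts A.obj (coyoneda.obj (op S)) }
  map f := ObjectProperty.homMk (Functor.whiskerRight f.hom _)

/-- The contravariant functor `S ↦ (A ↦ A ^ S)`. -/
def powers : (Type u)ᵒᵖ ⥤ CovFun T where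
  obj S := mop (powerFunctor T S.unop)
  map f := Quiver.Hom.mop
    { app A := ObjectProperty.homMk (Functor.whiskerLeft A.obj (coyoneda.map f)) }

variable {T}

lemma CovFun.hom_ext {G H : CovFun T} {α β : G ⟶ H}
    (h : ∀ (A : Variety T) (t : T) (x : (G.unmop.obj A).obj.obj t),
      (α.unmop.app A).hom.app t x = (β.unmop.app A).hom.app t x) : α = β := by
  apply Quiver.Hom.unmop_inj
  ext A : 2
  apply ObjectProperty.hom_ext
  ext t x
  exact h A t x

variable (T)

/-- Maps out of a point are elements. -/
def homPUnitEquiv (A : Type u) : A ≃ ((𝟙_ (Type u)) ⟶ A) where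
  toFun x := ↾fun _ => x
  invFun f := f PUnit.unit
  left_inv _ := rfl
  right_inv _ := rfl

/-- Currying, for maps in the category of types. -/
def homTensorEquiv (S S' A : Type u) : (S ⟶ (S' ⟶ A : Type u)) ≃ (S ⊗ S' ⟶ A) where
  toFun f := ↾fun p => ConcreteCategory.hom (f p.1) p.2
  invFun f := ↾fun a => ↾fun b => f (a, b)
  left_inv _ := rfl
  right_inv _ := rfl

/-- `A ≅ A ^ {*}`. -/
def powersUnitIso : 𝟙_ (CovFun T) ≅ (powers T).obj (𝟙_ _) :=
  (mopFunctor _).mapIso (NatIso.ofComponents fun A => (isModel T (Type u)).isoMk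
    (NatIso.ofComponents fun t =>
      (homPUnitEquiv (A.obj.obj t)).toIso))

/-- `(A ^ S') ^ S ≅ A ^ (S × S')`. -/
def powersTensorIso (S S' : (Type u)ᵒᵖ) :
    (powers T).obj S ⊗ (powers T).obj S' ≅ (powers T).obj (S ⊗ S') :=
  (mopFunctor _).mapIso (NatIso.ofComponents fun A => (isModel T (Type u)).isoMk
    (NatIso.ofComponents fun t =>
      (homTensorEquiv S.unop S'.unop (A.obj.obj t)).toIso))

/-- Powers turn products of sets into composites of functors. -/
def powersCoreMonoidal : (powers T).CoreMonoidal where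
  εIso := powersUnitIso T
  μIso := powersTensorIso T
  μIso_hom_natural_left _ _ := CovFun.hom_ext fun _ _ _ => rfl
  μIso_hom_natural_right _ _ := CovFun.hom_ext fun _ _ _ => rfl
  associativity _ _ _ := CovFun.hom_ext fun _ _ _ => rfl
  left_unitality _ := CovFun.hom_ext fun _ _ _ => rfl
  right_unitality _ := CovFun.hom_ext fun _ _ _ => rfl

end Power

section Lift

open MonoidalCategory

variable {C : Type u₁} [Category.{v₁} C] [MonoidalCategory C]
  {D : Type u₂} [Category.{v₂} D] [MonoidalCategory D]

/-- A monoidal functor into a monoidal category lifts to a monoidal full subcategory that contains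
its values. -/
def liftCoreMonoidal (P : ObjectProperty D) [P.IsMonoidal] {F : C ⥤ D} (hF : ∀ X, P (F.obj X))
    (h : F.CoreMonoidal) : (P.lift F hF).CoreMonoidal where
  εIso := P.isoMk h.εIso
  μIso X Y := P.isoMk (h.μIso X Y)
  μIso_hom_natural_left f X := P.hom_ext (h.μIso_hom_natural_left f X)
  μIso_hom_natural_right X f := P.hom_ext (h.μIso_hom_natural_right X f)
  associativity X Y Z := P.hom_ext (h.associativity X Y Z)
  left_unitality X := P.hom_ext (h.left_unitality X)
  right_unitality X := P.hom_ext (h.right_unitality X)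

end Lift

/-! ### Free models represent powers -/

section Single

variable {I : Type u}

open scoped Classical in
/-- Maps out of a graded set concentrated in one degree. -/
noncomputable def singleHomEquiv (i : I) (S : Type u) (Z : GradedObject I (Type u)) :
    ((GradedObject.single i).obj S ⟶ Z) ≃ (S ⟶ Z i) where
  toFun f := (GradedObject.singleObjApplyIso i S).inv ≫ f i
  invFun g j :=
    if h : j = i then (GradedObject.singleObjApplyIsoOfEq i S j h).hom ≫ g ≫ eqToHom (by rw [h])
    else (GradedObject.isInitialSingleObjApply i S j h).to (Z j)
  left_inv f := by
    funext j
    by_cases h : j = i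
    · subst h
      simp
    · exact (GradedObject.isInitialSingleObjApply i S j h).hom_ext _ _
  right_inv g := by simp

end Single

section Free

variable {T : Type u} [SmallCategory T] {I : Type u} {s : I → T}

variable (T) in
/-- Evaluation of endofunctors of the variety at an object of the theory. -/
def evalCovFun (t : T) : CovFun T ⥤ Variety T ⥤ Type u :=
  unmopFunctor _ ⋙
    (Functor.whiskeringRight _ _ _).obj ((isModel T (Type u)).ι ⋙ (evaluation T (Type u)).obj t)

open scoped Classical in
/-- The free model on `S` generators of degree `i` represents the `S`-th power in degree `i`. -/
noncomputable def freePowerIso {F : GradedObject I (Type u) ⥤ Variety T}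
    (adj : F ⊣ Model.underlying (Type u) s) (i : I) :
    (GradedObject.single i ⋙ F).op ⋙ coyoneda ≅ powers T ⋙ evalCovFun T (s i) :=
  NatIso.ofComponents
    (fun S => NatIso.ofComponents
      (fun A => ((adj.homEquiv _ A).trans (singleHomEquiv i S.unop _)).toIso)
      (fun {A B} f => by
        ext x
        change (singleHomEquiv i S.unop _) ((adj.homEquiv _ B) (x ≫ f)) = _
        rw [adj.homEquiv_naturality_right]
        rfl))
    (fun {S S'} f => by
      ext A x
      change (singleHomEquiv i S'.unop _) ((adj.homEquiv _ A) (F.map _ ≫ x)) =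
        f.unop ≫ (singleHomEquiv i S.unop _) ((adj.homEquiv _ A) x)
      rw [adj.homEquiv_naturality_left]
      exact GradedObject.singleObjApplyIso_inv_single_map_assoc i f.unop _)

lemma covRep_powers {F : GradedObject I (Type u) ⥤ Variety T}
    (adj : F ⊣ Model.underlying (Type u) s) (S : (Type u)ᵒᵖ) : covRep s ((powers T).obj S) := by
  classical
  exact ⟨fun i => F.obj ((GradedObject.single i).obj S.unop), fun i => ⟨(freePowerIso adj i).app S⟩⟩

/-- The underlying objects of a co-algebra object represent the functor it defines. -/
def underlyingCoyonedaIso (i : I) :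
    (CoModel.underlying (Variety T) s ⋙ Pi.eval _ i).op ⋙ coyoneda ≅
      toCovFun T ⋙ evalCovFun T (s i) :=
  Iso.refl _

open scoped Classical in
/-- A functor to co-algebra objects which represents powers is an extension of the free functor. -/
noncomputable def underlyingIso {F : GradedObject I (Type u) ⥤ Variety T}
    (adj : F ⊣ Model.underlying (Type u) s) (G : Type u ⥤ CoAlg T)
    (e : G.op ⋙ toCovFun T ≅ powers T) :
    G ⋙ CoModel.underlying (Variety T) s ≅ diag I ⋙ extend F :=
  -- In degree `i` both sides represent `A ↦ A(s i) ^ S`, naturally in `S`; Yoneda gives the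
  -- isomorphism.
  let e' (i : I) : (G ⋙ CoModel.underlying (Variety T) s ⋙ Pi.eval _ i).op ≅
      (GradedObject.single i ⋙ F).op :=
    ((Coyoneda.fullyFaithful (C := Variety T)).whiskeringRight (Type u)ᵒᵖ).preimageIso
      (Functor.isoWhiskerLeft G.op (underlyingCoyonedaIso i) ≪≫
        Functor.isoWhiskerRight e (evalCovFun T (s i)) ≪≫ (freePowerIso adj i).symm)
  let e'' (i : I) : G ⋙ CoModel.underlying (Variety T) s ⋙ Pi.eval _ i ≅
      GradedObject.single i ⋙ F := (NatIso.removeOp (e' i)).symm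
  NatIso.ofComponents (fun S => Pi.isoMk fun i => (e'' i).app S)
    (fun f => funext fun i => (e'' i).hom.naturality f)

end Free

/-! ### Transport of monoidal structures -/

section Transport

open MonoidalCategory

variable {C : Type u₁} [Category.{v₁} C] {D : Type u₂} [Category.{v₂} D] [MonoidalCategory D]

/-- A monoidal structure can be transported along an equivalence. -/
lemma exists_monoidalCategory_of_equivalence (e : D ≌ C) :
    ∃ _ : MonoidalCategory C, Nonempty e.functor.Monoidal ∧ Nonempty e.inverse.Monoidal :=
  have h : Nonempty (Monoidal.equivalenceTransported e).functor.Monoidal ∧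
    Nonempty (Monoidal.equivalenceTransported e).inverse.Monoidal :=
      ⟨⟨inferInstance⟩, ⟨inferInstance⟩⟩
  ⟨Monoidal.transport e, h⟩

/-- A monoidal structure can be transported along a contravariant equivalence `F`, in such a way
that contravariant monoidal functors lift along `F` to monoidal functors. -/
lemma exists_monoidalCategory_of_contravariant_equivalence (F : Cᵒᵖ ⥤ D) [F.IsEquivalence] :
    ∃ _ : MonoidalCategory C, Nonempty F.Monoidal ∧
      ∀ {X : Type u} [Category.{v} X] [MonoidalCategory X] (P : Xᵒᵖ ⥤ D) [P.Monoidal],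
        ∃ G : X ⥤ C, Nonempty G.Monoidal ∧ Nonempty (G.op ⋙ F ≅ P) := by
  let e : Dᵒᵖ ≌ C := F.asEquivalence.symm.leftOp
  obtain ⟨hC, ⟨h₁⟩, ⟨h₂⟩⟩ := exists_monoidalCategory_of_equivalence e
  -- The inverse of `e` is `F.rightOp` by definition.
  have : F.rightOp.Monoidal := h₂
  refine ⟨hC, ⟨monoidalOfRightOp F⟩, fun P hP => ?_⟩
  have := monoidalRightOp P
  exact ⟨P.rightOp ⋙ e.functor, ⟨inferInstance⟩,
    ⟨NatIso.ofComponents (fun S => F.asEquivalence.counitIso.app (P.obj S))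
      (fun f => F.asEquivalence.counitIso.hom.naturality (P.map f))⟩⟩

end Transport

end TallWraith

open TallWraith in
theorem mainTheorem3 {I T : Type u} [SmallCategory T] [HasFiniteProducts T] (s : I → T)
    (hs : IsGradedLawvereTheory s) :
    -- the forgetful functor to graded sets has a left adjoint (the free functor)
    (Model.underlying (Type u) s).IsRightAdjoint ∧
    -- representable endofunctors contain the identity and are closed under composition, and
    -- co-algebra objects carry a monoidal structure such that `X ↦ Hom(X, -)` is an equivalence of
    -- monoidal categories from the opposite category to representable endofunctors
    ∃ (_ : (covRep s).IsMonoidal) (_ : MonoidalCategory (CoAlg T)),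
      ((toCovRep s).IsEquivalence ∧ Nonempty (toCovRep s).Monoidal) ∧
      -- the free functor, extended degreewise and restricted along the diagonal functor, lifts to
      -- a strong monoidal functor
      ∀ (F : GradedObject I (Type u) ⥤ Variety T) (_ : F ⊣ Model.underlying (Type u) s),
        ∃ Fhat : Type u ⥤ CoAlg T,
          Nonempty Fhat.Monoidal ∧
          Nonempty (Fhat ⋙ CoModel.underlying (Variety T) s ≅ diag I ⋙ extend F) := by
  have hm := covRep_isMonoidal hs
  have he := toCovRep_isEquivalence hs
  obtain ⟨hC, hF, h⟩ := exists_monoidalCategory_of_contravariant_equivalence (toCovRep s)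
  refine ⟨isRightAdjoint_underlying s, hm, hC, ⟨he, hF⟩, fun F adj => ?_⟩
  -- The powers are defined without `F`; the adjunction only shows that they are representable and
  -- identifies the underlying objects.
  let P : (Type u)ᵒᵖ ⥤ (covRep s).FullSubcategory := (covRep s).lift (powers T) (covRep_powers adj)
  let _ : P.Monoidal := (liftCoreMonoidal (covRep s) _ (powersCoreMonoidal T)).toMonoidal
  obtain ⟨G, hG, ⟨e⟩⟩ := h P
  exact ⟨G, hG, ⟨underlyingIso adj G (Functor.isoWhiskerRight e (covRep s).ι)⟩⟩
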